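/- Let $F$ be a (real) Banach lattice with order continuous norm, i.e. $\|x_\alpha\|\to 0$ for every net $x_\alpha\downarrow 0$ in $F$. For a linear subspace $E\subset F$ put $S_E=\{e\in E:\|e\|=1\}$; a sequence $(f_n)_{n\in\mathbb{N}}$ in $F$ is disjoint if $|f_m|\wedge|f_n|=0$ for $m\neq n$. Call $E$ - dispersed if there is no sequence $(e_n)$ in $S_E$ for which there is a disjoint sequence $(f_n)$ in $F$ with $\|f_n-e_n\|\to 0$; - strictly dispersed if there is $\delta>0$ such that no disjoint sequence $(f_n)$ in $S_F$ satisfies $\operatorname{dist}(f_n,E)<\delta$ for all $n$; - weakly dispersed if $0$ has a neighbourhood disjoint from $S_E$ in the un-topology, the linear topology on $F$ whose basic neighbourhoods of zero are the sets $\{f\in F:\||f|\wedge h\|<\varepsilon\}$ with $h\in F_+$, $\varepsilon>0$; - strongly dispersed if $0$ has a neighbourhood disjoint from $S_E$ in the una-topology, which is defined in the same way but with $h$ ranging only over $F^a_+$, where $F^a$ is the closed ideal of order continuous elements of $F$ (those $x$ such that $\|x_\alpha\|\to0$ whenever $|x|\ge x_\alpha\downarrow 0$). Then for every subspace $E$ of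 $F$ the following are equivalent: $E$ is strongly dispersed; $E$ is strictly dispersed; $E$ is weakly dispersed; $E$ is dispersed. In particular, the set of dispersed closed subspaces of $F$ is open in the gap topology, i.e. the topology on the set of closed subspaces of $F$ induced by the metric $d(E,G)=\sup_{\|f\|=1}|\operatorname{dist}(f,E)-\operatorname{dist}(f,G)|$. -/

import Mathlib

open Set Filter Topology

/-! Banach lattices are real: a complete `NormedSpace ℝ F` with a vector lattice order
and a solid norm. -/

section BanachLattice

variable {F : Type*} [NormedAddCommGroup F] [Lattice F]

/-- The norm is order continuous: if a net decreases to `0` in order, its norms tend to `0`.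
The range of a decreasing net is a downward directed set, and the norm is monotone on the
positive cone, so it is enough that the norm takes arbitrarily small values on every downward
directed set with infimum `0`. -/
def HasOrderContinuousNorm (F : Type*) [NormedAddCommGroup F] [Lattice F] : Prop :=
  ∀ D : Set F, D.Nonempty → DirectedOn (fun a b => b ≤ a) D → IsGLB D 0 →
    ∀ ε : ℝ, 0 < ε → ∃ d ∈ D, ‖d‖ < ε

/-- `x` is an order continuous element: nets in the order interval `[0, |x|]` that decrease
to `0` in order converge to `0` in norm. -/
def IsOrderContinuousElement (x : F) : Prop :=
  ∀ D : Set F, D ⊆ Icc 0 |x| → D.Nonempty → DirectedOn (fun a b => b ≤ a) D → IsGLB D 0 →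
    ∀ ε : ℝ, 0 < ε → ∃ d ∈ D, ‖d‖ < ε

/-- The positive cone of `F`. -/
def positiveCone (F : Type*) [NormedAddCommGroup F] [Lattice F] : Set F :=
  {h | 0 ≤ h}

/-- The positive cone of the ideal of order continuous elements of `F`. -/
def orderContinuousPositiveCone (F : Type*) [NormedAddCommGroup F] [Lattice F] : Set F :=
  {h | 0 ≤ h ∧ IsOrderContinuousElement h}

/-- A disjoint sequence. -/
def IsDisjointSeq (f : ℕ → F) : Prop :=
  ∀ m n : ℕ, m ≠ n → |f m| ⊓ |f n| = 0

/-- The basic neighbourhood of zero `{f : ‖|f| ∧ h‖ < ε}`. -/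
def unboundedNhd (h : F) (ε : ℝ) : Set F :=
  {f | ‖|f| ⊓ h‖ < ε}

variable [IsOrderedAddMonoid F]

theorem inf_add_le_of_nonneg {a b c : F} (ha : 0 ≤ a) (hb : 0 ≤ b) (hc : 0 ≤ c) :
    c ⊓ (a + b) ≤ c ⊓ a + c ⊓ b := by
  have h1 : c ⊓ (a + b) - c ⊓ b ≤ c :=
    (sub_le_self _ (le_inf hc hb)).trans inf_le_left
  have h2 : c ⊓ (a + b) - c ⊓ b ≤ a := by
    rw [sub_le_iff_le_add]
    have : a + c ⊓ b = (a + c) ⊓ (a + b) := add_inf c b a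
    rw [this]
    exact le_inf (inf_le_left.trans (le_add_of_nonneg_left ha)) inf_le_right
  exact sub_le_iff_le_add.1 (le_inf h1 h2)

variable [HasSolidNorm F]

theorem norm_le_norm_of_nonneg_of_le {a b : F} (ha : 0 ≤ a) (hab : a ≤ b) : ‖a‖ ≤ ‖b‖ :=
  norm_le_norm_of_abs_le_abs (by rwa [abs_of_nonneg ha, abs_of_nonneg (ha.trans hab)])

theorem directedOn_positiveCone : DirectedOn (fun a b : F => a ≤ b) (positiveCone F) :=
  fun a ha b _ => ⟨a ⊔ b, le_sup_of_le_left ha, le_sup_left, le_sup_right⟩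

theorem zero_mem_orderContinuousPositiveCone : (0 : F) ∈ orderContinuousPositiveCone F := by
  refine ⟨le_rfl, fun D hD hne _ _ ε hε => ?_⟩
  obtain ⟨d, hd⟩ := hne
  have h0 := hD hd
  rw [abs_zero] at h0
  have : d = 0 := le_antisymm h0.2 h0.1
  exact ⟨d, hd, by simpa [this] using hε⟩

theorem add_mem_orderContinuousPositiveCone {a b : F}
    (ha : a ∈ orderContinuousPositiveCone F) (hb : b ∈ orderContinuousPositiveCone F) :
    a + b ∈ orderContinuousPositiveCone F := by
  refine ⟨add_nonneg ha.1 hb.1, fun D hD hne hdir hglb ε hε => ?_⟩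
  have hpos : ∀ d ∈ D, 0 ≤ d := fun d hd => (hD hd).1
  have key : ∀ c ∈ orderContinuousPositiveCone F, ∃ d ∈ D, ‖d ⊓ c‖ < ε / 2 := by
    intro c hc
    obtain ⟨e, ⟨d, hd, rfl⟩, hlt⟩ := hc.2 ((fun d => d ⊓ c) '' D)
      (by
        rintro _ ⟨d, hd, rfl⟩
        rw [abs_of_nonneg hc.1]
        exact ⟨le_inf (hpos d hd) hc.1, inf_le_right⟩)
      (hne.image _)
      (by
        rintro _ ⟨d, hd, rfl⟩ _ ⟨d', hd', rfl⟩
        obtain ⟨e, he, h1, h2⟩ := hdir d hd d' hd'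
        exact ⟨e ⊓ c, ⟨e, he, rfl⟩, inf_le_inf_right _ h1, inf_le_inf_right _ h2⟩)
      ⟨by
        rintro _ ⟨d, hd, rfl⟩
        exact le_inf (hpos d hd) hc.1,
       fun l hl => hglb.2 fun d hd => (hl ⟨d, hd, rfl⟩).trans inf_le_left⟩
      (ε / 2) (half_pos hε)
    exact ⟨d, hd, hlt⟩
  obtain ⟨d₁, hd₁, h1⟩ := key a ha
  obtain ⟨d₂, hd₂, h2⟩ := key b hb
  obtain ⟨d, hd, hle1, hle2⟩ := hdir d₁ hd₁ d₂ hd₂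
  refine ⟨d, hd, ?_⟩
  have hd0 := hpos d hd
  have hdab : d ≤ a + b := by
    have := (hD hd).2
    rwa [abs_of_nonneg (add_nonneg ha.1 hb.1)] at this
  have hle : d ≤ d ⊓ a + d ⊓ b :=
    (le_inf le_rfl hdab).trans (inf_add_le_of_nonneg ha.1 hb.1 hd0)
  calc ‖d‖ ≤ ‖d ⊓ a + d ⊓ b‖ := norm_le_norm_of_nonneg_of_le hd0 hle
    _ ≤ ‖d ⊓ a‖ + ‖d ⊓ b‖ := norm_add_le _ _
    _ ≤ ‖d₁ ⊓ a‖ + ‖d₂ ⊓ b‖ := add_le_add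
        (norm_le_norm_of_nonneg_of_le (le_inf hd0 ha.1) (inf_le_inf_right _ hle1))
        (norm_le_norm_of_nonneg_of_le (le_inf hd0 hb.1) (inf_le_inf_right _ hle2))
    _ < ε := by linarith

theorem directedOn_orderContinuousPositiveCone :
    DirectedOn (fun a b : F => a ≤ b) (orderContinuousPositiveCone F) :=
  fun _ ha _ hb => ⟨_, add_mem_orderContinuousPositiveCone ha hb,
    le_add_of_nonneg_right hb.1, le_add_of_nonneg_left ha.1⟩

/-- For an upward directed set `A` of positive elements, the sets `{f : ‖|f| ∧ h‖ < ε}` with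
`h ∈ A` and `ε > 0` form a basis of neighbourhoods of zero for a group topology. -/
abbrev unboundedFilterBasis (A : Set F) (hpos : A ⊆ positiveCone F) (hne : A.Nonempty)
    (hdir : DirectedOn (fun a b : F => a ≤ b) A) : AddGroupFilterBasis F where
  sets := {U | ∃ h ∈ A, ∃ ε : ℝ, 0 < ε ∧ U = unboundedNhd h ε}
  nonempty := by
    obtain ⟨h, hh⟩ := hne
    exact ⟨_, h, hh, 1, one_pos, rfl⟩
  inter_sets := by
    rintro _ _ ⟨h, hh, ε, hε, rfl⟩ ⟨k, hk, δ, hδ, rfl⟩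
    obtain ⟨l, hl, h1, h2⟩ := hdir h hh k hk
    refine ⟨_, ⟨l, hl, min ε δ, lt_min hε hδ, rfl⟩, fun f hf => ?_⟩
    have hf' : ‖|f| ⊓ l‖ < min ε δ := hf
    exact ⟨(norm_le_norm_of_nonneg_of_le (le_inf (abs_nonneg f) (hpos hh))
        (inf_le_inf_left _ h1)).trans_lt (hf'.trans_le (min_le_left _ _)),
      (norm_le_norm_of_nonneg_of_le (le_inf (abs_nonneg f) (hpos hk))
        (inf_le_inf_left _ h2)).trans_lt (hf'.trans_le (min_le_right _ _))⟩
  zero' := by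
    rintro _ ⟨h, hh, ε, hε, rfl⟩
    have h0 : (0 : F) ≤ h := hpos hh
    change ‖|(0 : F)| ⊓ h‖ < ε
    rw [abs_zero, inf_eq_left.2 h0, norm_zero]
    exact hε
  add' := by
    rintro _ ⟨h, hh, ε, hε, rfl⟩
    have h0 : (0 : F) ≤ h := hpos hh
    refine ⟨_, ⟨h, hh, ε / 2, half_pos hε, rfl⟩, ?_⟩
    rintro _ ⟨f, hf, g, hg, rfl⟩
    have hf' : ‖|f| ⊓ h‖ < ε / 2 := hf
    have hg' : ‖|g| ⊓ h‖ < ε / 2 := hg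
    have hle : |f + g| ⊓ h ≤ |f| ⊓ h + |g| ⊓ h := by
      calc |f + g| ⊓ h ≤ (|f| + |g|) ⊓ h := inf_le_inf_right _ (abs_add_le f g)
        _ = h ⊓ (|f| + |g|) := inf_comm _ _
        _ ≤ h ⊓ |f| + h ⊓ |g| := inf_add_le_of_nonneg (abs_nonneg f) (abs_nonneg g) h0
        _ = |f| ⊓ h + |g| ⊓ h := by rw [inf_comm h, inf_comm h]
    change ‖|f + g| ⊓ h‖ < ε
    calc ‖|f + g| ⊓ h‖ ≤ ‖|f| ⊓ h + |g| ⊓ h‖ :=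
          norm_le_norm_of_nonneg_of_le (le_inf (abs_nonneg _) h0) hle
      _ ≤ ‖|f| ⊓ h‖ + ‖|g| ⊓ h‖ := norm_add_le _ _
      _ < ε := by linarith
  neg' := by
    rintro _ ⟨h, hh, ε, hε, rfl⟩
    refine ⟨_, ⟨h, hh, ε, hε, rfl⟩, fun f hf => ?_⟩
    change ‖|-f| ⊓ h‖ < ε
    rw [abs_neg]
    exact hf
  conj' := by
    rintro f _ ⟨h, hh, ε, hε, rfl⟩
    refine ⟨_, ⟨h, hh, ε, hε, rfl⟩, fun g hg => ?_⟩
    simpa using hg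

/-- The unbounded norm (un-) topology. -/
abbrev unTopology (F : Type*) [NormedAddCommGroup F] [Lattice F] [IsOrderedAddMonoid F]
    [HasSolidNorm F] : TopologicalSpace F :=
  (unboundedFilterBasis (positiveCone F) subset_rfl ⟨0, le_refl (0 : F)⟩
    directedOn_positiveCone).topology

/-- The una-topology. -/
abbrev unaTopology (F : Type*) [NormedAddCommGroup F] [Lattice F] [IsOrderedAddMonoid F]
    [HasSolidNorm F] : TopologicalSpace F :=
  (unboundedFilterBasis (orderContinuousPositiveCone F) (fun _ h => h.1)
    ⟨0, zero_mem_orderContinuousPositiveCone⟩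
    directedOn_orderContinuousPositiveCone).topology

/-- Zero is separated from the set `S` with respect to the topology `t`. -/
def IsZeroSeparated (t : TopologicalSpace F) (S : Set F) : Prop :=
  ∃ U ∈ @nhds F t 0, U ∩ S = ∅

end BanachLattice

section Dispersed

variable {F : Type*} [NormedAddCommGroup F] [NormedSpace ℝ F] [Lattice F]

/-- The unit sphere of a subspace. -/
def unitSphere (E : Submodule ℝ F) : Set F :=
  {e | e ∈ E ∧ ‖e‖ = 1}

/-- `e` is an almost disjoint sequence: a normalized sequence that is asymptotic in norm
to some disjoint sequence. -/
def IsAlmostDisjointSeq (e : ℕ → F) : Prop :=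
  (∀ n, ‖e n‖ = 1) ∧
    ∃ f : ℕ → F, IsDisjointSeq f ∧ Tendsto (fun n => ‖f n - e n‖) atTop (𝓝 0)

/-- `E` is dispersed: it contains no almost disjoint sequence. -/
def IsDispersed (E : Submodule ℝ F) : Prop :=
  ¬ ∃ e : ℕ → F, (∀ n, e n ∈ E) ∧ IsAlmostDisjointSeq e

/-- `E` is strictly dispersed: for some `δ > 0` no normalized disjoint sequence of `F` stays
at distance less than `δ` from `E`. -/
def IsStrictlyDispersed (E : Submodule ℝ F) : Prop :=
  ∃ δ : ℝ, 0 < δ ∧ ¬ ∃ f : ℕ → F, (∀ n, ‖f n‖ = 1) ∧ IsDisjointSeq f ∧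
    ∀ n, Metric.infDist (f n) (E : Set F) < δ

variable [IsOrderedAddMonoid F] [HasSolidNorm F]

/-- `E` is weakly dispersed: zero is un-separated from the unit sphere of `E`. -/
def IsWeaklyDispersed (E : Submodule ℝ F) : Prop :=
  IsZeroSeparated (unTopology F) (unitSphere E)

/-- `E` is strongly dispersed: zero is una-separated from the unit sphere of `E`. -/
def IsStronglyDispersed (E : Submodule ℝ F) : Prop :=
  IsZeroSeparated (unaTopology F) (unitSphere E)

end Dispersed

section Gap

variable {X : Type*} [NormedAddCommGroup X] [NormedSpace ℝ X]

/-- The distance `sup {|dist (x, E) - dist (x, G)| : ‖x‖ = 1}` between closed subspaces. -/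
noncomputable def gapDist (E G : ClosedSubmodule ℝ X) : ℝ :=
  ⨆ x : Metric.sphere (0 : X) 1,
    |Metric.infDist (x : X) (E : Set X) - Metric.infDist (x : X) (G : Set X)|

theorem infDist_le_norm_closedSubmodule (E : ClosedSubmodule ℝ X) (x : X) :
    Metric.infDist x (E : Set X) ≤ ‖x‖ := by
  have h0 : (0 : X) ∈ (E : Set X) := E.toSubmodule.zero_mem
  simpa using Metric.infDist_le_dist_of_mem (x := x) h0

theorem abs_infDist_sub_le_gapDist (E G : ClosedSubmodule ℝ X) {x : X} (hx : ‖x‖ = 1) :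
    |Metric.infDist x (E : Set X) - Metric.infDist x (G : Set X)| ≤ gapDist E G := by
  have hb : BddAbove (Set.range fun x : Metric.sphere (0 : X) 1 =>
      |Metric.infDist (x : X) (E : Set X) - Metric.infDist (x : X) (G : Set X)|) := by
    refine ⟨1, ?_⟩
    rintro _ ⟨⟨y, hy⟩, rfl⟩
    have hy1 : ‖y‖ = 1 := by simpa using hy
    have h1 := infDist_le_norm_closedSubmodule E y
    have h2 := infDist_le_norm_closedSubmodule G y
    have h3 : 0 ≤ Metric.infDist y (E : Set X) := Metric.infDist_nonneg
    have h4 : 0 ≤ Metric.infDist y (G : Set X) := Metric.infDist_nonneg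
    rw [hy1] at h1 h2
    exact abs_le.2 ⟨by linarith, by linarith⟩
  exact le_ciSup hb ⟨x, by simpa using hx⟩

theorem gapDist_nonneg (E G : ClosedSubmodule ℝ X) : 0 ≤ gapDist E G :=
  Real.iSup_nonneg fun _ => abs_nonneg _

theorem le_of_gapDist_eq_zero {E G : ClosedSubmodule ℝ X} (h : gapDist E G = 0) :
    (E : Set X) ⊆ G := by
  intro x hx
  by_cases hx0 : x = 0
  · rw [hx0]
    exact G.toSubmodule.zero_mem
  have hn : ‖x‖ ≠ 0 := norm_ne_zero_iff.2 hx0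
  have hu : ‖(‖x‖⁻¹ : ℝ) • x‖ = 1 := by
    rw [norm_smul, norm_inv, norm_norm, inv_mul_cancel₀ hn]
  have huE : (‖x‖⁻¹ : ℝ) • x ∈ (E : Set X) := E.toSubmodule.smul_mem _ hx
  have hle := abs_infDist_sub_le_gapDist E G hu
  rw [h, Metric.infDist_zero_of_mem huE, zero_sub, abs_neg] at hle
  have hz : Metric.infDist ((‖x‖⁻¹ : ℝ) • x) (G : Set X) = 0 :=
    abs_eq_zero.1 (le_antisymm hle (abs_nonneg _))
  have huG : (‖x‖⁻¹ : ℝ) • x ∈ (G : Set X) :=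
    (G.isClosed.mem_iff_infDist_zero ⟨0, G.toSubmodule.zero_mem⟩).2 hz
  have := G.toSubmodule.smul_mem ‖x‖ huG
  rwa [smul_inv_smul₀ hn] at this

/-- The metric `gapDist` on the closed subspaces of a normed space. -/
noncomputable abbrev gapMetricSpace (X : Type*) [NormedAddCommGroup X] [NormedSpace ℝ X] :
    MetricSpace (ClosedSubmodule ℝ X) where
  dist := gapDist
  dist_self E := by simp [gapDist]
  dist_comm E G := by simp only [gapDist, abs_sub_comm]
  dist_triangle E G H := by
    refine Real.iSup_le ?_ (add_nonneg (gapDist_nonneg _ _) (gapDist_nonneg _ _))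
    rintro ⟨x, hx⟩
    have hx1 : ‖x‖ = 1 := by simpa using hx
    exact (abs_sub_le _ _ _).trans
      (add_le_add (abs_infDist_sub_le_gapDist E G hx1) (abs_infDist_sub_le_gapDist G H hx1))
  eq_of_dist_eq_zero {E G} h := by
    have h' : gapDist G E = 0 := by
      rw [← h]
      simp only [gapDist, abs_sub_comm]
    exact SetLike.coe_injective
      (Set.Subset.antisymm (le_of_gapDist_eq_zero h) (le_of_gapDist_eq_zero h'))

/-- The gap topology on the closed subspaces of a normed space. -/
noncomputable abbrev gapTopology (X : Type*) [NormedAddCommGroup X] [NormedSpace ℝ X] :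
    TopologicalSpace (ClosedSubmodule ℝ X) :=
  (gapMetricSpace X).toUniformSpace.toTopologicalSpace

end Gap

/-! The implications run dispersed ⇒ weakly ⇒ strictly ⇒ dispersed. The first is a Kadec–Pełczyński
argument (`exists_isAlmostDisjointSeq`): if the unit sphere of `E` is not un-separated from zero,
choose unit vectors nearly disjoint from large multiples of their predecessors, then cut off the
overlaps to make them exactly disjoint. The second rests on order continuity: order bounded disjoint
sequences are norm null, so every disjoint sequence is un-null and cannot stay close to a
un-separated sphere. The third only normalizes a tail. Order continuity also makes every element
order continuous, so the una- and un-topologies agree. Openness is read off from strict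
dispersedness, which mentions only distances from unit vectors to `E`, and these the gap metric
controls uniformly. -/

section DisjointSequences

variable {F : Type*} [NormedAddCommGroup F] [Lattice F] [IsOrderedAddMonoid F]

/-! ### Disjointness and truncation -/

theorem inf_add_eq_zero_of_inf_eq_zero {a b c : F} (ha : 0 ≤ a) (hb : 0 ≤ b) (hc : 0 ≤ c)
    (hca : c ⊓ a = 0) (hcb : c ⊓ b = 0) : c ⊓ (a + b) = 0 := by
  refine le_antisymm ?_ (le_inf hc (add_nonneg ha hb))
  simpa [hca, hcb] using inf_add_le_of_nonneg ha hb hc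

theorem inf_eq_zero_of_le {a b c d : F} (ha : 0 ≤ a) (hb : 0 ≤ b) (hac : a ≤ c) (hbd : b ≤ d)
    (h : c ⊓ d = 0) : a ⊓ b = 0 :=
  le_antisymm (h ▸ inf_le_inf hac hbd) (le_inf ha hb)

theorem sum_inf_eq_zero_of_pairwise {u : ℕ → F} (hu : ∀ n, 0 ≤ u n)
    (hd : ∀ m n, m ≠ n → u m ⊓ u n = 0) {n m : ℕ} (h : n ≤ m) :
    u m ⊓ ∑ i ∈ Finset.range n, u i = 0 := by
  induction n with
  | zero => simpa using hu m
  | succ n ih =>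
    rw [Finset.sum_range_succ]
    exact inf_add_eq_zero_of_inf_eq_zero (Finset.sum_nonneg fun i _ => hu i) (hu n) (hu m)
      (ih (by omega)) (hd _ _ (by omega))

theorem sum_le_of_pairwise {u : ℕ → F} {h : F} (hu : ∀ n, 0 ≤ u n) (huh : ∀ n, u n ≤ h)
    (hd : ∀ m n, m ≠ n → u m ⊓ u n = 0) (n : ℕ) : ∑ i ∈ Finset.range n, u i ≤ h := by
  induction n with
  | zero => simpa using (hu 0).trans (huh 0)
  | succ n ih =>
    -- A sum of two disjoint positive elements is their supremum.
    have h1 := inf_add_sup (u n) (∑ i ∈ Finset.range n, u i)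
    rw [sum_inf_eq_zero_of_pairwise hu hd le_rfl, zero_add] at h1
    rw [Finset.sum_range_succ, add_comm, ← h1]
    exact sup_le (huh n) ih

theorem sub_posPart_sub (a g : F) : a - (a - g)⁺ = a ⊓ g := by
  rw [posPart_def, sub_eq_add_neg, neg_sup, add_inf]
  simp [inf_comm]

theorem posPart_le_abs_self (a : F) : a⁺ ≤ |a| := sup_le (le_abs_self a) (abs_nonneg a)

theorem negPart_le_abs_self (a : F) : a⁻ ≤ |a| := sup_le (neg_le_abs a) (abs_nonneg a)

theorem abs_sub_le_abs_add_abs (a b : F) : |a - b| ≤ |a| + |b| := by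
  simpa [sub_eq_add_neg] using abs_add_le a (-b)

/-- The part of `e` that exceeds `g` in absolute value. -/
def excess (e g : F) : F := (e⁺ - g)⁺ - (e⁻ - g)⁺

theorem abs_excess_le (e g : F) : |excess e g| ≤ (|e| - g)⁺ + (|e| - g)⁺ := by
  have h1 : (e⁺ - g)⁺ ≤ (|e| - g)⁺ :=
    posPart_mono (sub_le_sub_right (posPart_le_abs_self e) g)
  have h2 : (e⁻ - g)⁺ ≤ (|e| - g)⁺ :=
    posPart_mono (sub_le_sub_right (negPart_le_abs_self e) g)
  calc |excess e g| ≤ |(e⁺ - g)⁺| + |(e⁻ - g)⁺| := abs_sub_le_abs_add_abs _ _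
    _ = (e⁺ - g)⁺ + (e⁻ - g)⁺ := by
        rw [abs_of_nonneg (posPart_nonneg _), abs_of_nonneg (posPart_nonneg _)]
    _ ≤ _ := add_le_add h1 h2

theorem excess_inf_excess_eq_zero {a b g k : F}
    (h : (|a| - g)⁺ ⊓ (|b| - k)⁺ = 0) : |excess a g| ⊓ |excess b k| = 0 := by
  have ha := posPart_nonneg (|a| - g)
  have hb := posPart_nonneg (|b| - k)
  refine inf_eq_zero_of_le (abs_nonneg _) (abs_nonneg _) (abs_excess_le a g) (abs_excess_le b k) ?_
  have h1 := inf_add_eq_zero_of_inf_eq_zero hb hb ha h h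
  rw [inf_comm] at h1 ⊢
  exact inf_add_eq_zero_of_inf_eq_zero ha ha (add_nonneg hb hb) h1 h1

variable [HasSolidNorm F]

/-- Truncating `e⁺` and `e⁻` separately removes exactly `e⁺ ⊓ g` and `e⁻ ⊓ g`, each dominated by
`|e| ⊓ g`. -/
theorem norm_excess_sub_le (e : F) {g : F} (hg : 0 ≤ g) :
    ‖excess e g - e‖ ≤ 2 * ‖|e| ⊓ g‖ := by
  have h : excess e g - e = e⁻ ⊓ g - e⁺ ⊓ g := by
    rw [← sub_posPart_sub, ← sub_posPart_sub, excess]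
    nth_rewrite 3 [← posPart_sub_negPart e]
    abel
  rw [h, two_mul]
  exact (norm_sub_le _ _).trans (add_le_add
    (norm_le_norm_of_nonneg_of_le (le_inf (negPart_nonneg e) hg)
      (inf_le_inf_right _ (negPart_le_abs_self e)))
    (norm_le_norm_of_nonneg_of_le (le_inf (posPart_nonneg e) hg)
      (inf_le_inf_right _ (posPart_le_abs_self e))))

theorem norm_abs_inf_le_add (e f : F) {h : F} (hh : 0 ≤ h) :
    ‖|e| ⊓ h‖ ≤ ‖|f| ⊓ h‖ + ‖f - e‖ := by
  have h1 : |e| ≤ |f| + |f - e| := by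
    have := abs_sub_le_abs_add_abs f (f - e)
    rwa [sub_sub_cancel] at this
  have h2 : |e| ⊓ h ≤ |f| ⊓ h + |f - e| := by
    have h3 := inf_add_le_of_nonneg (abs_nonneg f) (abs_nonneg (f - e)) hh
    rw [inf_comm, inf_comm |f|]
    exact (inf_le_inf_left _ h1).trans (h3.trans (by gcongr; exact inf_le_right))
  calc ‖|e| ⊓ h‖ ≤ ‖|f| ⊓ h + |f - e|‖ :=
        norm_le_norm_of_nonneg_of_le (le_inf (abs_nonneg e) hh) h2
    _ ≤ _ := (norm_add_le _ _).trans_eq (by rw [norm_abs_eq_norm])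

theorem isZeroSeparated_unboundedFilterBasis_iff (A : Set F) (hpos : A ⊆ positiveCone F)
    (hne : A.Nonempty) (hdir : DirectedOn (fun a b : F => a ≤ b) A) (S : Set F) :
    IsZeroSeparated (unboundedFilterBasis A hpos hne hdir).topology S ↔
      ∃ h ∈ A, ∃ ε : ℝ, 0 < ε ∧ ∀ f ∈ S, ε ≤ ‖|f| ⊓ h‖ := by
  have hb := (unboundedFilterBasis A hpos hne hdir).nhds_zero_hasBasis
  constructor
  · rintro ⟨U, hU, hUS⟩
    obtain ⟨V, ⟨h, hh, ε, hε, rfl⟩, hVU⟩ := hb.mem_iff.1 hU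
    refine ⟨h, hh, ε, hε, fun f hf => not_lt.1 fun hlt => ?_⟩
    have : f ∈ U ∩ S := ⟨hVU hlt, hf⟩
    rw [hUS] at this
    exact this
  · rintro ⟨h, hh, ε, hε, hS⟩
    refine ⟨unboundedNhd h ε, hb.mem_of_mem (i := unboundedNhd h ε) ⟨h, hh, ε, hε, rfl⟩, ?_⟩
    exact eq_empty_of_forall_notMem fun f hf => not_lt.2 (hS f hf.2) hf.1

end DisjointSequences

section OrderContinuous

variable {F : Type*} [NormedAddCommGroup F] [NormedSpace ℝ F] [Lattice F]
  [IsOrderedAddMonoid F] [IsOrderedModule ℝ F] [HasSolidNorm F]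

/-! ### Order bounded disjoint sequences -/

theorem nonpos_of_forall_nsmul_le {l b : F} (h : ∀ k : ℕ, k • l ≤ b) : l ≤ 0 := by
  have h1 : ∀ k : ℕ, l ≤ (1 / ((k : ℝ) + 1)) • b := fun k => by
    have h2 := smul_le_smul_of_nonneg_left (h (k + 1))
      (show (0 : ℝ) ≤ 1 / ((k : ℝ) + 1) by positivity)
    rwa [← Nat.cast_smul_eq_nsmul ℝ, smul_smul, Nat.cast_add, Nat.cast_one,
      one_div_mul_cancel (by positivity), one_smul] at h2
  have h3 : Tendsto (fun k : ℕ => (1 / ((k : ℝ) + 1)) • b) atTop (𝓝 ((0 : ℝ) • b)) :=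
    tendsto_one_div_add_atTop_nhds_zero_nat.smul_const b
  rw [zero_smul] at h3
  exact ge_of_tendsto' h3 h1

/-- If the norm is order continuous, an order bounded disjoint sequence is norm null. -/
theorem tendsto_norm_zero_of_disjoint_of_le (hF : HasOrderContinuousNorm F) {u : ℕ → F} {h : F}
    (hu : ∀ n, 0 ≤ u n) (huh : ∀ n, u n ≤ h) (hd : ∀ m n, m ≠ n → u m ⊓ u n = 0) :
    Tendsto (fun n => ‖u n‖) atTop (𝓝 0) := by
  set s : ℕ → F := fun n => ∑ i ∈ Finset.range n, u i with hs
  have hmono : Monotone s := fun m n hmn =>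
    Finset.sum_le_sum_of_subset_of_nonneg (Finset.range_mono hmn) fun i _ _ => hu i
  -- The partial sums need not be known to have a supremum: gaps between upper bounds and partial
  -- sums have infimum `0`. Subtracting a lower bound `l` of `D` from an upper bound gives another
  -- one, so `k • l ≤ h` for all `k`, and the Archimedean property applies.
  let D : Set F := {d | ∃ b ∈ upperBounds (range s), ∃ n, d = b - s n}
  have hsh : h ∈ upperBounds (range s) := by
    rintro _ ⟨n, rfl⟩
    exact sum_le_of_pairwise hu huh hd n
  have hD : ∀ ε : ℝ, 0 < ε → ∃ d ∈ D, ‖d‖ < ε := by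
    refine hF D ⟨_, h, hsh, 0, rfl⟩ ?_ ⟨?_, fun l hl => ?_⟩
    · rintro _ ⟨b, hb, n, rfl⟩ _ ⟨c, hc, m, rfl⟩
      refine ⟨_, ⟨b ⊓ c, ?_, max n m, rfl⟩,
        sub_le_sub inf_le_left (hmono (le_max_left _ _)),
        sub_le_sub inf_le_right (hmono (le_max_right _ _))⟩
      exact fun x hx => le_inf (hb hx) (hc hx)
    · rintro _ ⟨b, hb, n, rfl⟩
      exact sub_nonneg.2 (hb ⟨n, rfl⟩)
    · have hk : ∀ k : ℕ, h - k • l ∈ upperBounds (range s) := by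
        intro k
        induction k with
        | zero => simpa using hsh
        | succ k ih =>
          rintro _ ⟨n, rfl⟩
          have := hl ⟨_, ih, n, rfl⟩
          rw [succ_nsmul, ← sub_sub]
          exact le_sub_comm.1 this
      refine nonpos_of_forall_nsmul_le (b := h) fun k => ?_
      have := hk k ⟨0, rfl⟩
      simpa [hs] using this
  rw [Metric.tendsto_atTop]
  intro ε hε
  obtain ⟨_, ⟨b, hb, n, rfl⟩, hlt⟩ := hD ε hε
  refine ⟨n, fun m hm => ?_⟩
  rw [dist_zero_right, norm_norm]
  refine (norm_le_norm_of_nonneg_of_le (hu m) ?_).trans_lt hlt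
  have h1 : s (m + 1) ≤ b := hb ⟨_, rfl⟩
  have h2 : s (m + 1) = s m + u m := Finset.sum_range_succ _ _
  have h3 := hmono hm
  rw [le_sub_iff_add_le]
  calc u m + s n ≤ u m + s m := by gcongr
    _ ≤ b := by rwa [add_comm, ← h2]

theorem IsDisjointSeq.tendsto_norm_abs_inf (hF : HasOrderContinuousNorm F) {f : ℕ → F}
    (hf : IsDisjointSeq f) {h : F} (hh : 0 ≤ h) :
    Tendsto (fun n => ‖|f n| ⊓ h‖) atTop (𝓝 0) :=
  have h0 : ∀ n, 0 ≤ |f n| ⊓ h := fun n => le_inf (abs_nonneg _) hh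
  tendsto_norm_zero_of_disjoint_of_le hF (h := h) h0 (fun _ => inf_le_right) fun m n hmn =>
    inf_eq_zero_of_le (h0 m) (h0 n) inf_le_left inf_le_left (hf m n hmn)

/-! ### Extraction of almost disjoint sequences -/

/-- The two truncations lie below the positive and negative parts of the single element `a - c • b`.
-/
theorem posPart_sub_inf_posPart_sub_eq_zero {a b g k : F} {c : ℝ} (hc : 1 ≤ c)
    (hg : c • b ≤ g) (hk : c⁻¹ • a ≤ k) : (a - g)⁺ ⊓ (b - k)⁺ = 0 := by
  have hc0 : 0 < c := one_pos.trans_le hc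
  refine inf_eq_zero_of_le (posPart_nonneg _) (posPart_nonneg _)
    (posPart_mono (sub_le_sub_left hg a)) (d := (a - c • b)⁻) ?_ (posPart_inf_negPart_eq_zero _)
  have h1 : b - k ≤ c⁻¹ • -(a - c • b) := by
    rw [neg_sub, smul_sub, smul_smul, inv_mul_cancel₀ hc0.ne', one_smul]
    exact sub_le_sub_left hk b
  have h2 : c⁻¹ • -(a - c • b) ≤ (a - c • b)⁻ := by
    calc c⁻¹ • -(a - c • b) ≤ c⁻¹ • (a - c • b)⁻ :=
          smul_le_smul_of_nonneg_left (neg_le_negPart _) (inv_nonneg.2 hc0.le)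
      _ ≤ (1 : ℝ) • (a - c • b)⁻ :=
          smul_le_smul_of_nonneg_right (inv_le_one_of_one_le₀ hc) (negPart_nonneg _)
      _ = _ := one_smul _ _
  exact sup_le (h1.trans h2) (negPart_nonneg _)

/-- A set of unit vectors that is not un-separated from zero contains an almost disjoint
sequence. -/
theorem exists_isAlmostDisjointSeq [CompleteSpace F] {S : Set F} (hS : ∀ e ∈ S, ‖e‖ = 1)
    (h : ∀ k : F, 0 ≤ k → ∀ ε : ℝ, 0 < ε → ∃ e ∈ S, ‖|e| ⊓ k‖ < ε) :
    ∃ e : ℕ → F, (∀ n, e n ∈ S) ∧ IsAlmostDisjointSeq e := by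
  -- Positivity of `s` sits inside the conclusion so that `choose` yields a total function, usable
  -- in the recursion.
  have hstep : ∀ (n : ℕ) (s : F), ∃ e ∈ S, 0 ≤ s → ‖|e| ⊓ (2 : ℝ) ^ n • s‖ < 1 / 2 ^ n := by
    intro n s
    by_cases hs : 0 ≤ s
    · obtain ⟨e, he, hlt⟩ := h _ (smul_nonneg (by positivity : (0 : ℝ) ≤ 2 ^ n) hs)
        (1 / 2 ^ n) (by positivity)
      exact ⟨e, he, fun _ => hlt⟩
    · obtain ⟨e, he, -⟩ := h 0 le_rfl 1 one_pos
      exact ⟨e, he, fun h0 => absurd h0 hs⟩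
  choose pick hpick hlt using hstep
  -- `s n` is the sum of `|e i|` over `i < n`.
  let s : ℕ → F := fun n => Nat.rec 0 (fun n x => x + |pick n x|) n
  let e : ℕ → F := fun n => pick n (s n)
  have heS : ∀ n, e n ∈ S := fun n => hpick _ _
  have he1 : ∀ n, ‖e n‖ = 1 := fun n => hS _ (heS n)
  have hsucc : ∀ n, s (n + 1) = s n + |e n| := fun n => rfl
  have hmono : Monotone s := monotone_nat_of_le_succ fun n => by
    rw [hsucc]
    exact le_add_of_nonneg_right (abs_nonneg _)
  have hs0 : ∀ n, 0 ≤ s n := fun n => hmono n.zero_le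
  have hes : ∀ {m n}, m < n → |e m| ≤ s n := fun {m _} hmn =>
    le_trans (by rw [hsucc]; exact le_add_of_nonneg_left (hs0 m)) (hmono hmn)
  -- The weight is `2⁻ⁱ` with `i = n + 1 + k`, written in the shape of `hasSum_geometric_two'`.
  let v : ℕ → ℕ → F := fun n k => ((1 : ℝ) / 2 ^ n / 2 / 2 ^ k) • |e (n + 1 + k)|
  have hv0 : ∀ n k, 0 ≤ v n k := fun n k => smul_nonneg (by positivity) (abs_nonneg _)
  have hvn : ∀ n k, ‖v n k‖ ≤ (1 : ℝ) / 2 ^ n / 2 / 2 ^ k := fun n k => by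
    rw [norm_smul, norm_abs_eq_norm, he1, mul_one, Real.norm_of_nonneg (by positivity)]
  have hgeo : ∀ n : ℕ, HasSum (fun k : ℕ => (1 : ℝ) / 2 ^ n / 2 / 2 ^ k) (1 / 2 ^ n) :=
    fun n => hasSum_geometric_two' _
  have hsum : ∀ n, Summable (v n) := fun n => Summable.of_norm_bounded (hgeo n).summable (hvn n)
  let t : ℕ → F := fun n => ∑' k, v n k
  have ht0 : ∀ n, 0 ≤ t n := fun n => tsum_nonneg (hv0 n)
  have htn : ∀ n, ‖t n‖ ≤ 1 / 2 ^ n := fun n => tsum_of_norm_bounded (hgeo n) (hvn n)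
  have het : ∀ {m n}, m < n → ((2 : ℝ) ^ n)⁻¹ • |e n| ≤ t m := by
    intro m n hmn
    obtain ⟨k, rfl⟩ := Nat.exists_eq_add_of_le (Nat.succ_le_of_lt hmn)
    have h1 : v m k ≤ t m := (hsum m).le_tsum k fun j _ => hv0 m j
    have h2 : (1 : ℝ) / 2 ^ m / 2 / 2 ^ k = (2 ^ (m + 1 + k))⁻¹ := by
      rw [pow_add, pow_succ]
      field_simp
    change ((1 : ℝ) / 2 ^ m / 2 / 2 ^ k) • |e (m + 1 + k)| ≤ t m at h1
    rwa [h2] at h1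
  -- For `m < n`, the first summand of `g n` dominates `2ⁿ|e m|`, while the tail `t m` in `g m`
  -- dominates `2⁻ⁿ|e n|`: the two hypotheses of the truncation lemma with `c = 2ⁿ`.
  let g : ℕ → F := fun n => (2 : ℝ) ^ n • s n + t n
  have hs2 : ∀ n, 0 ≤ (2 : ℝ) ^ n • s n := fun n => smul_nonneg (by positivity) (hs0 n)
  have hg0 : ∀ n, 0 ≤ g n := fun n => add_nonneg (hs2 n) (ht0 n)
  have hdisj : ∀ {m n}, m < n → |excess (e n) (g n)| ⊓ |excess (e m) (g m)| = 0 := by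
    intro m n hmn
    refine excess_inf_excess_eq_zero (posPart_sub_inf_posPart_sub_eq_zero (c := 2 ^ n)
      (one_le_pow₀ one_le_two) ?_ ?_)
    · exact (smul_le_smul_of_nonneg_left (hes hmn) (by positivity)).trans
        (le_add_of_nonneg_right (ht0 n))
    · exact (het hmn).trans (le_add_of_nonneg_left (hs2 m))
  have hbound : ∀ n, ‖excess (e n) (g n) - e n‖ ≤ 4 * (1 / 2) ^ n := by
    intro n
    have h1 : |e n| ⊓ g n ≤ |e n| ⊓ (2 : ℝ) ^ n • s n + t n :=
      (inf_add_le_of_nonneg (hs2 n) (ht0 n) (abs_nonneg _)).trans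
        (by gcongr; exact inf_le_right)
    have h2 := norm_le_norm_of_nonneg_of_le (le_inf (abs_nonneg (e n)) (hg0 n)) h1
    have h3 := norm_add_le (|e n| ⊓ (2 : ℝ) ^ n • s n) (t n)
    have h4 : ‖|e n| ⊓ (2 : ℝ) ^ n • s n‖ < 1 / 2 ^ n := hlt n (s n) (hs0 n)
    have h5 := norm_excess_sub_le (e n) (hg0 n)
    have h6 := htn n
    rw [one_div_pow]
    linarith
  refine ⟨e, heS, he1, fun n => excess (e n) (g n), fun m n hmn => ?_, ?_⟩
  · rcases hmn.lt_or_gt with h1 | h1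
    · rw [inf_comm]
      exact hdisj h1
    · exact hdisj h1
  · refine squeeze_zero (fun n => norm_nonneg _) hbound ?_
    simpa using (tendsto_pow_atTop_nhds_zero_of_lt_one (r := (1 / 2 : ℝ))
      (by norm_num) (by norm_num)).const_mul 4

/-! ### The equivalences -/

theorem isWeaklyDispersed_iff {E : Submodule ℝ F} :
    IsWeaklyDispersed E ↔
      ∃ h : F, 0 ≤ h ∧ ∃ ε : ℝ, 0 < ε ∧ ∀ e ∈ unitSphere E, ε ≤ ‖|e| ⊓ h‖ :=
  isZeroSeparated_unboundedFilterBasis_iff _ _ _ _ _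

theorem isStronglyDispersed_iff_isWeaklyDispersed (hF : HasOrderContinuousNorm F)
    {E : Submodule ℝ F} : IsStronglyDispersed E ↔ IsWeaklyDispersed E := by
  refine (isZeroSeparated_unboundedFilterBasis_iff _ _ _ _ _).trans
    (Iff.trans ?_ isWeaklyDispersed_iff.symm)
  exact ⟨fun ⟨h, hh, H⟩ => ⟨h, hh.1, H⟩,
    fun ⟨h, hh, H⟩ => ⟨h, ⟨hh, fun D _ => hF D⟩, H⟩⟩

theorem IsDispersed.isWeaklyDispersed [CompleteSpace F] {E : Submodule ℝ F}
    (hE : IsDispersed E) : IsWeaklyDispersed E := by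
  rw [isWeaklyDispersed_iff]
  by_contra! hcon
  obtain ⟨e, he, hd⟩ := exists_isAlmostDisjointSeq (S := unitSphere E) (fun e he => he.2) hcon
  exact hE ⟨e, fun n => (he n).1, hd⟩

/-- Normalizing moves `e` by `|‖e‖ - 1|`, which is at most `‖f - e‖`. -/
theorem norm_sub_normalize_le {f e : F} {δ : ℝ} (hf : ‖f‖ = 1) (he : e ≠ 0)
    (h : ‖f - e‖ < δ) : ‖f - ‖e‖⁻¹ • e‖ ≤ 2 * δ := by
  have h0 : ‖e‖ ≠ 0 := norm_ne_zero_iff.2 he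
  have h1 : ‖e - ‖e‖⁻¹ • e‖ = |‖e‖ - ‖f‖| := by
    have : e - ‖e‖⁻¹ • e = (1 - ‖e‖⁻¹) • e := by rw [sub_smul, one_smul]
    rw [this, norm_smul, Real.norm_eq_abs, ← abs_norm e, ← abs_mul, abs_norm, sub_mul,
      inv_mul_cancel₀ h0, one_mul, hf]
  have h2 : |‖e‖ - ‖f‖| ≤ ‖f - e‖ := by
    rw [norm_sub_rev]
    exact abs_norm_sub_norm_le e f
  have h3 := norm_sub_le_norm_sub_add_norm_sub f e (‖e‖⁻¹ • e)
  linarith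

theorem IsWeaklyDispersed.isStrictlyDispersed (hF : HasOrderContinuousNorm F)
    {E : Submodule ℝ F} (hE : IsWeaklyDispersed E) : IsStrictlyDispersed E := by
  obtain ⟨h, hh, ε, hε, hS⟩ := isWeaklyDispersed_iff.1 hE
  -- The bound `1/2` keeps the approximant nonzero. After normalization `ε/4` becomes an error of
  -- `ε/2`, leaving `ε/2` for `|f n| ⊓ h`.
  refine ⟨min (1 / 2) (ε / 4), by positivity, ?_⟩
  rintro ⟨f, hf1, hfd, hdist⟩
  obtain ⟨n, hn⟩ := ((hfd.tendsto_norm_abs_inf hF hh).eventually_lt_const (half_pos hε)).exists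
  obtain ⟨e, heE, he⟩ := (Metric.infDist_lt_iff ⟨0, E.zero_mem⟩).1 (hdist n)
  rw [dist_eq_norm] at he
  have he0 : e ≠ 0 := by
    rintro rfl
    have := he.trans_le (min_le_left _ _)
    rw [sub_zero, hf1] at this
    norm_num at this
  have h1 := norm_sub_normalize_le (hf1 n) he0 (he.trans_le (min_le_right _ _))
  have h2 := hS (‖e‖⁻¹ • e) ⟨E.smul_mem _ heE, by
    rw [norm_smul, norm_inv, norm_norm, inv_mul_cancel₀ (norm_ne_zero_iff.2 he0)]⟩
  have h3 := norm_abs_inf_le_add (‖e‖⁻¹ • e) (f n) hh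
  linarith

theorem abs_smul_le_smul_abs {a : ℝ} (ha : 0 ≤ a) (x : F) : |a • x| ≤ a • |x| :=
  abs_le'.2 ⟨smul_le_smul_of_nonneg_left (le_abs_self x) ha, by
    rw [← smul_neg]
    exact smul_le_smul_of_nonneg_left (neg_le_abs x) ha⟩

/-- Disjointness is additive, hence passes to natural multiples, and these dominate nonnegative real
ones. -/
theorem IsDisjointSeq.smul {f : ℕ → F} (hf : IsDisjointSeq f) {c : ℕ → ℝ} (hc : ∀ n, 0 ≤ c n) :
    IsDisjointSeq fun n => c n • f n := by
  have key : ∀ (a : ℝ) (x y : F), 0 ≤ a → |x| ⊓ |y| = 0 → |a • x| ⊓ |y| = 0 := by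
    intro a x y ha hxy
    obtain ⟨k, hk⟩ := exists_nat_ge a
    have h1 : ∀ k : ℕ, |y| ⊓ k • |x| = 0 := by
      intro k
      induction k with
      | zero => simp
      | succ k ih =>
        rw [succ_nsmul]
        exact inf_add_eq_zero_of_inf_eq_zero (nsmul_nonneg (abs_nonneg x) k) (abs_nonneg x)
          (abs_nonneg y) ih (by rwa [inf_comm])
    refine inf_eq_zero_of_le (abs_nonneg _) (abs_nonneg _) ?_ le_rfl ((inf_comm _ _).trans (h1 k))
    rw [← Nat.cast_smul_eq_nsmul ℝ]
    exact (abs_smul_le_smul_abs ha x).trans <| smul_le_smul_of_nonneg_right hk (abs_nonneg x)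
  intro m n hmn
  refine key _ _ _ (hc m) ?_
  rw [inf_comm]
  exact key _ _ _ (hc n) (by rw [inf_comm]; exact hf m n hmn)

theorem IsStrictlyDispersed.isDispersed {E : Submodule ℝ F} (hE : IsStrictlyDispersed E) :
    IsDispersed E := by
  obtain ⟨δ, hδ, hE⟩ := hE
  rintro ⟨e, heE, he1, f, hfd, hlim⟩
  -- Beyond `N` the `f n` are nonzero, and normalizing them leaves them within `δ/2` of `e n`.
  obtain ⟨N, hN⟩ := eventually_atTop.1
    (hlim.eventually_lt_const (show 0 < min (1 / 2) (δ / 4) by positivity))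
  have hf0 : ∀ n, f (n + N) ≠ 0 := fun n h0 => by
    have := (hN (n + N) (by omega)).trans_le (min_le_left _ _)
    rw [h0, zero_sub, norm_neg, he1] at this
    norm_num at this
  refine hE ⟨fun n => ‖f (n + N)‖⁻¹ • f (n + N), fun n => ?_, ?_, fun n => ?_⟩
  · rw [norm_smul, norm_inv, norm_norm, inv_mul_cancel₀ (norm_ne_zero_iff.2 (hf0 n))]
  · exact IsDisjointSeq.smul (f := fun n => f (n + N))
      (fun m n hmn => hfd _ _ (by omega)) fun n => inv_nonneg.2 (norm_nonneg _)
  · refine (Metric.infDist_le_dist_of_mem (heE (n + N))).trans_lt ?_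
    have h1 := (hN (n + N) (by omega)).trans_le (min_le_right _ _)
    rw [norm_sub_rev] at h1
    have h2 := norm_sub_normalize_le (he1 (n + N)) (hf0 n) h1
    rw [dist_eq_norm, norm_sub_rev]
    linarith

/-! ### Openness in the gap topology -/

theorem isOpen_isStrictlyDispersed :
    IsOpen[gapTopology F] {E : ClosedSubmodule ℝ F | IsStrictlyDispersed E.toSubmodule} := by
  let _ := gapMetricSpace F
  refine Metric.isOpen_iff.2 ?_
  rintro E ⟨δ, hδ, hE⟩
  -- Half of `δ` pays for the change of subspace; the other half is the constant for `G`.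
  refine ⟨δ / 2, half_pos hδ, fun G hG => ⟨δ / 2, half_pos hδ, ?_⟩⟩
  rintro ⟨f, hf1, hfd, hdist⟩
  refine hE ⟨f, hf1, hfd, fun n => ?_⟩
  have h1 : gapDist G E < δ / 2 := hG
  have h2 := (abs_le.1 (abs_infDist_sub_le_gapDist G E (hf1 n))).1
  have h3 : Metric.infDist (f n) (G : Set F) < δ / 2 := hdist n
  change Metric.infDist (f n) (E : Set F) < δ
  linarith

end OrderContinuous

theorem mainTheorem2 {F : Type*} [NormedAddCommGroup F] [NormedSpace ℝ F] [CompleteSpace F]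
    [Lattice F] [IsOrderedAddMonoid F] [IsOrderedModule ℝ F] [HasSolidNorm F]
    (hF : HasOrderContinuousNorm F) :
    (∀ E : Submodule ℝ F,
      (IsStronglyDispersed E ↔ IsDispersed E) ∧
      (IsStrictlyDispersed E ↔ IsDispersed E) ∧
      (IsWeaklyDispersed E ↔ IsDispersed E)) ∧
    IsOpen[gapTopology F] {E : ClosedSubmodule ℝ F | IsDispersed E.toSubmodule} := by
  have hstrict : ∀ E : Submodule ℝ F, IsStrictlyDispersed E ↔ IsDispersed E := fun E =>
    ⟨fun h => h.isDispersed, fun h => h.isWeaklyDispersed.isStrictlyDispersed hF⟩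
  have hweak : ∀ E : Submodule ℝ F, IsWeaklyDispersed E ↔ IsDispersed E := fun E =>
    ⟨fun h => (h.isStrictlyDispersed hF).isDispersed, fun h => h.isWeaklyDispersed⟩
  refine ⟨fun E => ⟨(isStronglyDispersed_iff_isWeaklyDispersed hF).trans (hweak E), hstrict E,
    hweak E⟩, ?_⟩
  simpa only [hstrict] using isOpen_isStrictlyDispersed (F := F)
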